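/- A \emph{two-player win-lose coordination game} $G=(C_1,C_2,W)$ consists of disjoint finite non-empty sets $C_1,C_2$ (the choices of players $1$ and $2$) and a winning relation $W\subseteq C_1\times C_2$ such that every choice occurs in some pair of $W$. It is an \emph{$m$-choice game} if $m=\max\{|C_1|,|C_2|\}$. The \emph{choice matching game} $\mathrm{CM}_m$ ($m\ge 1$) has $m$ choices for each player, and $W$ consists of $m$ pairwise disjoint pairs. In a repeated play of $G$ the players, in each round, simultaneously and independently make a choice, until the pair chosen is in $W$; a \emph{stage} $(G,\mathcal H_k)$ records the game and the sequence of the $k$ pairs chosen so far. A \emph{protocol} assigns to each player in each stage of each game a probability distribution on the choices of that player. A \emph{renaming} between two stages $(G,\mathcal H_k)$ and $(G',\mathcal H'_k)$ is a permutation of the two players together with a bijection between the choices that respects it and preserves, in both directions, the winning relation and the pair chosen in each round. A protocol is \emph{structural} if the probabilities that it assigns are preserved by all renamings between stages. The \emph{expected coordination time} (ECT) of a protocol in $G$ is the expected number (possibly $\infty$) of rounds until coordination, starting from the empty history, when both players follow the protocol. The \emph{optimal ECT} of $G$ is the least ECT in $G$ among all structural protocols. The \emph{wait-or-move protocol} $\mathrm{WM}$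 is the following: in the first round each player makes a uniformly random choice $c$; thereafter, as long as there has been no coordination, the player selects with probability $\tfrac12$ the choice $c$ again, and with probability $\tfrac12$ a choice $c'$ that wins against the initial choice of the other player. (If there are several such $c'$, any rule may be used for selecting among them.) \textbf{Theorem (safety of WM).} Let $m\ge 1$, $m\notin\{1,3,5\}$, and let $G$ be an $m$-choice two-player win-lose coordination game that is not isomorphic to $\mathrm{CM}_m$ (that is, there is no renaming between their initial stages). Then the optimal ECT of $\mathrm{CM}_m$ exists, and the ECT of $\mathrm{WM}$ in $G$ is strictly smaller than it. -/

import Mathlib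

open scoped ENNReal

noncomputable section

/-- A two-player win-lose coordination game. `C i` is the finite non-empty set of choices of
player `i` (the choice sets of the two players are disjoint, being different types), and `W` is
the set of winning choice profiles. No choice is surely losing. -/
structure WLCGame where
  C : Fin 2 → Type
  fintypeC : ∀ i, Fintype (C i)
  nonemptyC : ∀ i, Nonempty (C i)
  W : Set (∀ i, C i)
  no_losing : ∀ (i : Fin 2) (c : C i), ∃ σ ∈ W, σ i = c

namespace WLCGame

attribute [instance] WLCGame.fintypeC WLCGame.nonemptyC

/-- Choice profiles. -/
abbrev Profile (G : WLCGame) : Type := ∀ i, G.C i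

/-- The history of a stage: the choice profiles played so far, in chronological order. A stage of
the repeated play of `G` is `G` together with such a history. -/
abbrev History (G : WLCGame) : Type := List G.Profile

/-- `G` is an `m`-choice game if the larger one of the two choice sets has `m` elements. -/
def IsChoiceGame (G : WLCGame) (m : ℕ) : Prop :=
  max (Fintype.card (G.C 0)) (Fintype.card (G.C 1)) = m

/-- The choice matching game with `m` choices for each player: the winning profiles are `m`
pairwise disjoint edges. -/
def CM (m : ℕ) [NeZero m] : WLCGame where
  C := fun _ => Fin m
  fintypeC := fun _ => inferInstance
  nonemptyC := fun _ => ⟨0⟩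
  W := {σ | σ 0 = σ 1}
  no_losing := fun _ c => ⟨fun _ => c, rfl, rfl⟩

/-- A renaming between the stages `(G, H)` and `(G', H')`: a permutation `perm` of the players and
a bijection between the choices that sends the choices of player `perm i` in `G` to the choices of
player `i` in `G'` and preserves the winning relation and the history in both directions. -/
structure Renaming (G G' : WLCGame) (H : G.History) (H' : G'.History) where
  perm : Equiv.Perm (Fin 2)
  map : ∀ i, G.C (perm i) ≃ G'.C i
  win_iff : ∀ σ : G.Profile, σ ∈ G.W ↔ (fun i => map i (σ (perm i))) ∈ G'.W
  hist_eq : H' = H.map (fun σ i => map i (σ (perm i)))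

/-- Two games are the same up to a renaming of choices and players. -/
def Isomorphic (G G' : WLCGame) : Prop := Nonempty (Renaming G G' [] [])

end WLCGame

open WLCGame

/-- A protocol gives a probability distribution on the choices of each player, in every stage of
every game. -/
abbrev Protocol : Type 1 := ∀ (G : WLCGame) (_ : G.History) (i : Fin 2), PMF (G.C i)

namespace Protocol

/-- A protocol is structural if it is indifferent with respect to renamings. -/
def IsStructural (π : Protocol) : Prop :=
  ∀ (G G' : WLCGame) (H : G.History) (H' : G'.History) (r : Renaming G G' H H')
    (i : Fin 2) (c : G.C (r.perm i)), π G H (r.perm i) c = π G' H' i (r.map i c)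

/-- The probability that the profile `σ` is played in the next round from the stage `(G, H)`: the
players choose independently. -/
def profileProb (π : Protocol) (G : WLCGame) (H : G.History) (σ : G.Profile) : ℝ≥0∞ :=
  ∏ i, π G H i (σ i)

open Classical in
/-- The probability that, starting from the stage `(G, H)`, the players fail to coordinate in the
next `k` rounds and coordinate in the round after these. -/
def firstCoordProb (π : Protocol) (G : WLCGame) : ℕ → G.History → ℝ≥0∞
  | 0, H => ∑ σ with σ ∈ G.W, π.profileProb G H σ
  | k + 1, H => ∑ σ with σ ∉ G.W, π.profileProb G H σ * firstCoordProb π G k (H ++ [σ])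

/-- The expected coordination time from the stage `(G, H)`: the expected value of the number of
rounds until coordination, this number being `∞` for a play that never coordinates. -/
def ECTFrom (π : Protocol) (G : WLCGame) (H : G.History) : ℝ≥0∞ :=
  (∑' k : ℕ, ((k + 1 : ℕ) : ℝ≥0∞) * π.firstCoordProb G k H)
    + ⊤ * (1 - ∑' k : ℕ, π.firstCoordProb G k H)

/-- The expected coordination time in `G`, that is, from the initial stage. -/
def ECT (π : Protocol) (G : WLCGame) : ℝ≥0∞ := π.ECTFrom G []

/-- `π` is a wait-or-move protocol: in the initial stage it selects uniformly at random. In a stage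
with initial profile `σ₀`, not winning, it selects the player's own initial choice `σ₀ i` with
probability `1/2`, and otherwise (hence also with total probability `1/2`) some choice that wins
against the initial choice of the other player. How the protocol selects among several such choices
is left open. -/
structure IsWaitOrMove (π : Protocol) : Prop where
  initial : ∀ (G : WLCGame) (i : Fin 2), π G [] i = PMF.uniformOfFintype (G.C i)
  wait : ∀ (G : WLCGame) (σ₀ : G.Profile) (H : G.History) (i : Fin 2),
    σ₀ ∉ G.W → π G (σ₀ :: H) i (σ₀ i) = 1 / 2
  move : ∀ (G : WLCGame) (σ₀ : G.Profile) (H : G.History) (i : Fin 2) (c : G.C i),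
    σ₀ ∉ G.W → c ≠ σ₀ i → π G (σ₀ :: H) i c ≠ 0 → Function.update σ₀ i c ∈ G.W

end Protocol

/-- `e` is the optimal expected coordination time in `G`: the least one that a structural protocol
gives. -/
def WLCGame.IsOptimalECT (G : WLCGame) (e : ℝ≥0∞) : Prop :=
  IsLeast {t : ℝ≥0∞ | ∃ π : Protocol, π.IsStructural ∧ π.ECT G = t} e

/-! The notion of a wait-or-move protocol is satisfied, by a structural protocol: -/

open Classical in
/-- The choices of player `i` that win against the choice of the other player in `σ`. -/
def WLCGame.replies (G : WLCGame) (σ : G.Profile) (i : Fin 2) : Finset (G.C i) :=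
  Finset.univ.filter fun c => Function.update σ i c ∈ G.W

theorem WLCGame.replies_nonempty (G : WLCGame) (σ : G.Profile) (i : Fin 2) :
    (G.replies σ i).Nonempty := by
  obtain ⟨τ, hτ, h⟩ := G.no_losing (1 - i) (σ (1 - i))
  refine ⟨τ i, ?_⟩
  have : Function.update σ i (τ i) = τ := by
    funext j
    by_cases hj : j = i
    · subst hj; simp
    · have : j = 1 - i := by omega
      subst this
      rw [Function.update_of_ne hj, h]
  simp [WLCGame.replies, this, hτ]

/-- The wait-or-move protocol that selects uniformly among the choices that win against the initial
choice of the other player, whenever it moves. -/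
def waitOrMove : Protocol
  | G, [], i => PMF.uniformOfFintype (G.C i)
  | G, σ₀ :: _, i => (PMF.uniformOfFintype Bool).bind fun wait =>
      if wait then PMF.pure (σ₀ i) else PMF.uniformOfFinset (G.replies σ₀ i) (G.replies_nonempty σ₀ i)

open Classical in
theorem waitOrMove_cons_apply (G : WLCGame) (σ : G.Profile) (H : G.History) (i : Fin 2)
    (c : G.C i) : waitOrMove G (σ :: H) i c =
      2⁻¹ * (if c = σ i then 1 else 0) +
        2⁻¹ * (if Function.update σ i c ∈ G.W then ((G.replies σ i).card : ℝ≥0∞)⁻¹ else 0) := by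
  simp [waitOrMove, PMF.bind_apply, tsum_fintype, PMF.uniformOfFinset_apply, WLCGame.replies]

theorem waitOrMove_isWaitOrMove : waitOrMove.IsWaitOrMove where
  initial _ _ := rfl
  wait G σ H i h := by
    classical
    rw [waitOrMove_cons_apply]
    simp [h]
  move G σ H i c h hc h0 := by
    classical
    rw [waitOrMove_cons_apply] at h0
    by_contra hw
    simp [hc, hw] at h0

theorem WLCGame.Renaming.update_mem_iff {G G' : WLCGame} {H : G.History} {H' : G'.History}
    (r : Renaming G G' H H') (σ : G.Profile) (i : Fin 2) (c : G.C (r.perm i)) :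
    Function.update σ (r.perm i) c ∈ G.W ↔
      Function.update (fun j => r.map j (σ (r.perm j))) i (r.map i c) ∈ G'.W := by
  rw [r.win_iff]
  have : (fun j => r.map j (Function.update σ (r.perm i) c (r.perm j))) =
      Function.update (fun j => r.map j (σ (r.perm j))) i (r.map i c) := by
    funext j
    by_cases hj : j = i
    · subst hj; simp
    · rw [Function.update_of_ne hj, Function.update_of_ne (by simpa using hj)]
  rw [this]

theorem waitOrMove_isStructural : waitOrMove.IsStructural := by
  classical
  intro G G' H H' r i c
  cases H with
  | nil =>
    have h := r.hist_eq
    simp only [List.map_nil] at h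
    subst h
    simp [waitOrMove, Fintype.card_congr (r.map i)]
  | cons σ T =>
    have h := r.hist_eq
    simp only [List.map_cons] at h
    have h2 := congrArg (fun K => waitOrMove G' K i (r.map i c)) h
    refine Eq.trans ?_ h2.symm
    simp only [waitOrMove_cons_apply]
    have hcard : (G.replies σ (r.perm i)).card =
        (G'.replies (fun j => r.map j (σ (r.perm j))) i).card := by
      refine Finset.card_equiv (r.map i) fun c => ?_
      simp [WLCGame.replies, r.update_mem_iff]
    simp only [hcard, r.update_mem_iff, EmbeddingLike.apply_eq_iff_eq]

end

section

open WLCGame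

namespace Protocol

/-! Both halves of the argument meet at the value `3 - 2 / m`.

Upper bound. After a missed first round, a wait-or-move play wins whenever exactly one player leaves
the initial choice, so each later round succeeds with probability at least 1/2 and at most 2 further
rounds are expected. With a uniform first round the ECT is at most `3 - 2|W| / (|C₁||C₂|)`
(`ECT_le`). Every choice lies on a winning pair, so `|W| ≥ m`, and `|C₁||C₂| < m|W|` unless `|C₁| =
|C₂| = |W| = m`, which forces a choice matching game (`card_mul_card_lt`). Hence the bound is
strictly below `3 - 2 / m` in `G`, and at most that in `CM m`.

Lower bound. In `CM m`, follow only plays whose stage keeps a symmetry exchanging the players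
through an involution `φ` of the edges. A structural protocol then gives both players the same
distribution `P` up to `φ`, and it is constant on the fixed points of `φ`, which are untouched
edges. On moved edges, two independent draws agree (a miss that preserves the symmetry) at least as
often as they are mirror images (coordination), by `2xy ≤ x² + y²`. On `k` fixed edges a miss has `k
- 1` times the probability of coordination and removes two fixed points (`le_sum_mirrored`).
Induction on `k` gives the bound 2 from any such stage, except for `k = 1` and `k = 3`
(`mirroredBound_le_ECTFrom`). From the empty history, where all edges are fixed, one round leads to
`m - 2` fixed edges, and `1 + 2(1 - 1/m) = 3 - 2/m`. -/

theorem sum_apply (π : Protocol) (G : WLCGame) (H : G.History) (i : Fin 2) :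
    ∑ c, π G H i c = 1 := by
  rw [← tsum_fintype (L := .unconditional _)]; exact (π G H i).tsum_coe

theorem sum_profileProb (π : Protocol) (G : WLCGame) (H : G.History) :
    ∑ σ, π.profileProb G H σ = 1 := by
  have := Finset.prod_univ_sum (fun i => (Finset.univ : Finset (G.C i))) (fun i c => π G H i c)
  simp only [sum_apply, Finset.prod_const_one, Fintype.piFinset_univ] at this
  exact this.symm

/-! ### Expected coordination time as a sum of tail probabilities. -/

open Classical in
/-- The probability that, starting from the stage `(G, H)`, the players fail to coordinate in the
next `k` rounds. -/
noncomputable def missProb (π : Protocol) (G : WLCGame) : ℕ → G.History → ℝ≥0∞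
  | 0, _ => 1
  | k + 1, H => ∑ σ with σ ∉ G.W, π.profileProb G H σ * missProb π G k (H ++ [σ])

theorem firstCoordProb_add_missProb (π : Protocol) (G : WLCGame) (k : ℕ) (H : G.History) :
    π.firstCoordProb G k H + π.missProb G (k + 1) H = π.missProb G k H := by
  classical
  induction k generalizing H with
  | zero =>
    simp only [firstCoordProb, missProb, mul_one]
    rw [Finset.sum_filter_add_sum_filter_not, sum_profileProb]
  | succ k ih =>
    rw [firstCoordProb, missProb, missProb, ← Finset.sum_add_distrib]
    refine Finset.sum_congr rfl fun σ _ => ?_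
    rw [← mul_add, ih]

theorem antitone_missProb (π : Protocol) (G : WLCGame) (H : G.History) :
    Antitone fun k => π.missProb G k H :=
  antitone_nat_of_succ_le fun k => by
    rw [← firstCoordProb_add_missProb π G k H]; exact le_add_self

/-- The one-step identity telescopes. The infimum is the probability of never coordinating. -/
theorem missProb_eq_tsum_add (π : Protocol) (G : WLCGame) (H : G.History) (j : ℕ) :
    π.missProb G j H = ∑' k, π.firstCoordProb G (k + j) H + ⨅ k, π.missProb G k H := by
  have hsum : ∀ n, ∑ k ∈ Finset.range n, π.firstCoordProb G (k + j) H
      + π.missProb G (n + j) H = π.missProb G j H := by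
    intro n
    induction n with
    | zero => simp
    | succ n ih =>
      rw [Finset.sum_range_succ, add_assoc, add_right_comm n 1 j,
        firstCoordProb_add_missProb, ih]
  have h1 : Filter.Tendsto (fun n => ∑ k ∈ Finset.range n, π.firstCoordProb G (k + j) H)
      Filter.atTop (nhds (∑' k, π.firstCoordProb G (k + j) H)) := ENNReal.tendsto_nat_tsum _
  have h2 : Filter.Tendsto (fun n => π.missProb G (n + j) H) Filter.atTop
      (nhds (⨅ k, π.missProb G k H)) :=
    (tendsto_atTop_iInf (antitone_missProb π G H)).comp (Filter.tendsto_add_atTop_nat j)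
  have h3 := h1.add h2
  simp only [hsum] at h3
  exact tendsto_nhds_unique tendsto_const_nhds h3

/-- Grouping by `n = k + j`, the term `f n` occurs once for each of the `n + 1` pairs of the
antidiagonal. -/
theorem tsum_tsum_add_eq (f : ℕ → ℝ≥0∞) :
    ∑' j : ℕ, ∑' k : ℕ, f (k + j) = ∑' n : ℕ, ((n + 1 : ℕ) : ℝ≥0∞) * f n := by
  rw [← ENNReal.tsum_prod (f := fun j k => f (k + j)),
    ← Equiv.tsum_eq (Finset.HasAntidiagonal.sigmaAntidiagonalEquivProd (A := ℕ)) fun p : ℕ × ℕ => f (p.2 + p.1),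
    ENNReal.tsum_sigma']
  refine tsum_congr fun n => ?_
  rw [tsum_fintype]
  have : ∀ p : Finset.HasAntidiagonal.antidiagonal n,
      f ((Finset.HasAntidiagonal.sigmaAntidiagonalEquivProd ⟨n, p⟩).2
        + (Finset.HasAntidiagonal.sigmaAntidiagonalEquivProd ⟨n, p⟩).1) = f n := by
    rintro ⟨⟨a, b⟩, h⟩
    have h' : a + b = n := by simpa using h
    simp [Finset.HasAntidiagonal.sigmaAntidiagonalEquivProd, add_comm b a, h']
  rw [Finset.sum_congr rfl fun p _ => this p]
  simp

/-- The expected coordination time is the sum of the tail probabilities. -/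
theorem ECTFrom_eq_tsum_missProb (π : Protocol) (G : WLCGame) (H : G.History) :
    π.ECTFrom G H = ∑' k, π.missProb G k H := by
  set L := ⨅ k, π.missProb G k H with hL
  have h0 := missProb_eq_tsum_add π G H 0
  simp only [add_zero, missProb, ← hL] at h0
  have hfin : ∑' k, π.firstCoordProb G k H ≠ ⊤ := by
    intro h
    rw [h] at h0
    simp at h0
  have h1 : 1 - ∑' k, π.firstCoordProb G k H = L := by
    rw [h0, ENNReal.add_sub_cancel_left hfin]
  -- Summing the constant `L` over all rounds produces `⊤ * L`, which is the penalty for plays that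
  -- never coordinate; it vanishes when `L = 0`.
  rw [ECTFrom, h1, tsum_congr (missProb_eq_tsum_add π G H), ENNReal.tsum_add,
    tsum_tsum_add_eq fun k => π.firstCoordProb G k H, ENNReal.tsum_const]
  simp [hL]

open Classical in
theorem ECTFrom_eq_one_add (π : Protocol) (G : WLCGame) (H : G.History) :
    π.ECTFrom G H =
      1 + ∑ σ with σ ∉ G.W, π.profileProb G H σ * π.ECTFrom G (H ++ [σ]) := by
  rw [ECTFrom_eq_tsum_missProb, tsum_eq_zero_add' ENNReal.summable]
  simp only [missProb, ECTFrom_eq_tsum_missProb]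
  rw [Summable.tsum_finsetSum fun _ _ => ENNReal.summable]
  simp only [ENNReal.tsum_mul_left]

theorem one_le_ECTFrom (π : Protocol) (G : WLCGame) (H : G.History) : 1 ≤ π.ECTFrom G H := by
  rw [ECTFrom_eq_one_add]; exact le_self_add

end Protocol

theorem WLCGame.profile_eq {G : WLCGame} {σ τ : G.Profile} (h0 : σ 0 = τ 0) (h1 : σ 1 = τ 1) :
    σ = τ := by
  funext i
  fin_cases i
  · exact h0
  · exact h1

theorem WLCGame.sum_profile (G : WLCGame) (f : G.Profile → ℝ≥0∞) :
    ∑ σ, f σ = ∑ a : G.C 0, ∑ b : G.C 1, f ((piFinTwoEquiv G.C).symm (a, b)) := by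
  rw [← (piFinTwoEquiv G.C).symm.sum_comp, Fintype.sum_prod_type]

theorem WLCGame.piFinTwoEquiv_symm_zero (G : WLCGame) (a : G.C 0) (b : G.C 1) :
    (piFinTwoEquiv G.C).symm (a, b) 0 = a := rfl

theorem WLCGame.piFinTwoEquiv_symm_one (G : WLCGame) (a : G.C 0) (b : G.C 1) :
    (piFinTwoEquiv G.C).symm (a, b) 1 = b := rfl

namespace Protocol

theorem profileProb_eq_mul (π : Protocol) (G : WLCGame) (H : G.History) (σ : G.Profile) :
    π.profileProb G H σ = π G H 0 (σ 0) * π G H 1 (σ 1) := by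
  rw [profileProb, Fin.prod_univ_two]

/-! ### Upper bound for wait-or-move protocols. -/

namespace IsWaitOrMove

open Classical in
theorem sum_profileProb_le {π : Protocol} (hπ : π.IsWaitOrMove) {G : WLCGame} {σ₀ : G.Profile}
    (h₀ : σ₀ ∉ G.W) (H : G.History) :
    ∑ σ with σ ∉ G.W, π.profileProb G (σ₀ :: H) σ ≤ 2⁻¹ := by
  have hle : ∀ σ : G.Profile, (if σ ∉ G.W then π.profileProb G (σ₀ :: H) σ else 0) ≤
      if (σ 0 = σ₀ 0 ↔ σ 1 = σ₀ 1) then π.profileProb G (σ₀ :: H) σ else 0 := by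
    intro σ
    by_cases hW : σ ∈ G.W
    · simp [hW]
    by_cases hiff : (σ 0 = σ₀ 0 ↔ σ 1 = σ₀ 1)
    · simp [hW, hiff]
    simp only [hW, hiff, not_false_eq_true, if_true, if_false, nonpos_iff_eq_zero]
    rw [profileProb_eq_mul, mul_eq_zero]
    by_cases h0 : σ 0 = σ₀ 0
    · right
      by_contra hne
      have h1 : σ 1 ≠ σ₀ 1 := fun h => hiff ⟨fun _ => h, fun _ => h0⟩
      have := hπ.move G σ₀ H 1 (σ 1) h₀ h1 hne
      refine hW ?_
      convert this
      exact profile_eq (by simp [h0]) (by simp)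
    · left
      by_contra hne
      have h1 : σ 1 = σ₀ 1 := by
        by_contra h
        exact hiff ⟨fun h' => absurd h' h0, fun h' => absurd h' h⟩
      have := hπ.move G σ₀ H 0 (σ 0) h₀ h0 hne
      refine hW ?_
      convert this
      exact profile_eq (by simp) (by simp [h1])
  have hQ0 : π G (σ₀ :: H) 1 (σ₀ 1) = 2⁻¹ := by rw [hπ.wait G σ₀ H 1 h₀, one_div]
  have hQ : ∑ b ∈ Finset.univ.erase (σ₀ 1), π G (σ₀ :: H) 1 b = 2⁻¹ := by
    have h := sum_apply π G (σ₀ :: H) 1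
    rw [← Finset.add_sum_erase _ _ (Finset.mem_univ (σ₀ 1)), hQ0, ← ENNReal.inv_two_add_inv_two]
      at h
    exact (ENNReal.add_right_inj (by simp)).1 h
  rw [Finset.sum_filter]
  refine (Finset.sum_le_sum fun σ _ => hle σ).trans ?_
  rw [sum_profile]
  simp only [profileProb_eq_mul, piFinTwoEquiv_symm_zero, piFinTwoEquiv_symm_one]
  have hrow : ∀ a : G.C 0, (∑ b : G.C 1, if (a = σ₀ 0 ↔ b = σ₀ 1) then
      π G (σ₀ :: H) 0 a * π G (σ₀ :: H) 1 b else 0) = π G (σ₀ :: H) 0 a * 2⁻¹ := by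
    intro a
    by_cases ha : a = σ₀ 0
    · simp [ha, hQ0]
    · simp only [ha, false_iff]
      rw [← Finset.sum_filter, ← Finset.mul_sum, ← hQ]
      congr 2
      ext b
      simp
  rw [Finset.sum_congr rfl fun a _ => hrow a, ← Finset.sum_mul, sum_apply, one_mul]

theorem missProb_cons_le {π : Protocol} (hπ : π.IsWaitOrMove) {G : WLCGame} {σ₀ : G.Profile}
    (h₀ : σ₀ ∉ G.W) (k : ℕ) (H : G.History) : π.missProb G k (σ₀ :: H) ≤ 2⁻¹ ^ k := by
  classical
  induction k generalizing H with
  | zero => simp [missProb]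
  | succ k ih =>
    rw [missProb, pow_succ']
    calc _ ≤ ∑ σ with σ ∉ G.W, π.profileProb G (σ₀ :: H) σ * 2⁻¹ ^ k :=
          Finset.sum_le_sum fun σ _ => by
            rw [List.cons_append]; exact mul_le_mul_right (ih _) _
      _ ≤ _ := by
        rw [← Finset.sum_mul]
        exact mul_le_mul_left (hπ.sum_profileProb_le h₀ H) _

theorem ECTFrom_cons_le {π : Protocol} (hπ : π.IsWaitOrMove) {G : WLCGame} {σ₀ : G.Profile}
    (h₀ : σ₀ ∉ G.W) (H : G.History) : π.ECTFrom G (σ₀ :: H) ≤ 2 := by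
  rw [ECTFrom_eq_tsum_missProb]
  refine (ENNReal.tsum_le_tsum fun k => hπ.missProb_cons_le h₀ k H).trans ?_
  rw [ENNReal.tsum_geometric, ENNReal.one_sub_inv_two, inv_inv]

theorem profileProb_nil {π : Protocol} (hπ : π.IsWaitOrMove) (G : WLCGame) (σ : G.Profile) :
    π.profileProb G [] σ =
      (Fintype.card (G.C 0) : ℝ≥0∞)⁻¹ * (Fintype.card (G.C 1) : ℝ≥0∞)⁻¹ := by
  simp [profileProb_eq_mul, hπ.initial]

open Classical in
theorem ECT_le {π : Protocol} (hπ : π.IsWaitOrMove) (G : WLCGame) :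
    π.ECT G ≤ ENNReal.ofReal (3 - 2 * (Fintype.card G.W : ℝ) /
      (Fintype.card (G.C 0) * Fintype.card (G.C 1))) := by
  have h0 : 0 < Fintype.card (G.C 0) := Fintype.card_pos
  have h1 : 0 < Fintype.card (G.C 1) := Fintype.card_pos
  have hcard : (Finset.univ.filter fun σ => σ ∉ G.W).card + Fintype.card G.W =
      Fintype.card (G.C 0) * Fintype.card (G.C 1) := by
    have := Finset.card_filter_add_card_filter_not (s := (Finset.univ : Finset G.Profile))
      (fun σ => σ ∈ G.W)
    rw [Finset.card_univ, Fintype.card_pi, Fin.prod_univ_two] at this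
    rw [← this, Fintype.card_subtype, add_comm]
  rw [ECT, ECTFrom_eq_one_add]
  calc _ ≤ 1 + ∑ σ with σ ∉ G.W, (Fintype.card (G.C 0) : ℝ≥0∞)⁻¹ *
          (Fintype.card (G.C 1) : ℝ≥0∞)⁻¹ * 2 := by
        gcongr with σ hσ
        · exact (hπ.profileProb_nil G σ).le
        · exact hπ.ECTFrom_cons_le (Finset.mem_filter.1 hσ).2 []
    _ = ENNReal.ofReal (1 + (Finset.univ.filter fun σ => σ ∉ G.W).card *
          ((Fintype.card (G.C 0) : ℝ)⁻¹ * (Fintype.card (G.C 1) : ℝ)⁻¹ * 2)) := by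
        rw [ENNReal.ofReal_add zero_le_one (by positivity), ENNReal.ofReal_mul (by positivity),
          ENNReal.ofReal_mul (by positivity), ENNReal.ofReal_mul (by positivity),
          ENNReal.ofReal_inv_of_pos (by positivity), ENNReal.ofReal_inv_of_pos (by positivity)]
        simp
    _ ≤ _ := by
        refine ENNReal.ofReal_le_ofReal (le_of_eq ?_)
        have hc : ((Finset.univ.filter fun σ => σ ∉ G.W).card : ℝ) =
            Fintype.card (G.C 0) * Fintype.card (G.C 1) - Fintype.card G.W := by
          rw [eq_sub_iff_add_eq]; exact_mod_cast hcard
        rw [hc]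
        field_simp
        ring

end IsWaitOrMove

end Protocol

/-! ### Counting winning profiles. -/

namespace WLCGame

theorem surjective_eval_W (G : WLCGame) (i : Fin 2) :
    Function.Surjective fun w : G.W => w.1 i := fun c => by
  obtain ⟨σ, hσ, h⟩ := G.no_losing i c
  exact ⟨⟨σ, hσ⟩, h⟩

open Classical in
/-- If both players have exactly as many choices as there are winning profiles, the game is a choice
matching game. -/
theorem isomorphic_CM_of_card_eq {G : WLCGame} {m : ℕ} [NeZero m]
    (h0 : Fintype.card (G.C 0) = m) (h1 : Fintype.card (G.C 1) = m)
    (hW : Fintype.card G.W = m) : G.Isomorphic (CM m) := by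
  -- Each choice lies in exactly one winning profile, which serves as its label; two choices win
  -- together exactly when their labels agree.
  have hb : ∀ i, Function.Bijective fun w : G.W => w.1 i := fun i => by
    refine (Fintype.bijective_iff_surjective_and_card _).2 ⟨G.surjective_eval_W i, ?_⟩
    fin_cases i
    · exact hW.trans h0.symm
    · exact hW.trans h1.symm
  let e : ∀ i, G.C i ≃ Fin m := fun i =>
    (Equiv.ofBijective _ (hb i)).symm.trans (Fintype.equivFinOfCardEq hW)
  refine ⟨⟨1, e, fun σ => ?_, rfl⟩⟩
  change σ ∈ G.W ↔ e 0 (σ 0) = e 1 (σ 1)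
  simp only [e, Equiv.trans_apply, EmbeddingLike.apply_eq_iff_eq]
  have hs : ∀ w : G.W, ∀ i, (Equiv.ofBijective _ (hb i)).symm (w.1 i) = w := fun w i =>
    (Equiv.ofBijective _ (hb i)).symm_apply_apply w
  constructor
  · intro h
    rw [hs ⟨σ, h⟩ 0, hs ⟨σ, h⟩ 1]
  · intro h
    set w := (Equiv.ofBijective _ (hb 0)).symm (σ 0) with hw
    have e0 : w.1 0 = σ 0 := (Equiv.ofBijective _ (hb 0)).apply_symm_apply (σ 0)
    have e1 : w.1 1 = σ 1 := by
      rw [h]; exact (Equiv.ofBijective _ (hb 1)).apply_symm_apply (σ 1)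
    rw [← profile_eq e0 e1]
    exact w.2

open Classical in
-- With `m ≤ |W|` and both choice sets of size at most `m`, strictness comes from a choice set
-- smaller than `m`, or else from `|W| > m`, since `|W| = m` would give `CM m`.
theorem card_mul_card_lt {G : WLCGame} {m : ℕ} [NeZero m] (hG : G.IsChoiceGame m)
    (hne : ¬ G.Isomorphic (CM m)) :
    Fintype.card (G.C 0) * Fintype.card (G.C 1) < Fintype.card G.W * m := by
  have hw : ∀ i, Fintype.card (G.C i) ≤ Fintype.card G.W := fun i =>
    Fintype.card_le_of_surjective _ (G.surjective_eval_W i)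
  have hm : 0 < m := NeZero.pos m
  have h0 := hw 0
  have h1 := hw 1
  unfold IsChoiceGame at hG
  have l0 : Fintype.card (G.C 0) ≤ m := hG ▸ le_max_left _ _
  have l1 : Fintype.card (G.C 1) ≤ m := hG ▸ le_max_right _ _
  have hmw : m ≤ Fintype.card G.W := hG ▸ max_le h0 h1
  by_cases e : Fintype.card (G.C 0) = m ∧ Fintype.card (G.C 1) = m
  · have : m < Fintype.card G.W :=
      lt_of_le_of_ne hmw fun h => hne (isomorphic_CM_of_card_eq e.1 e.2 h.symm)
    rw [e.1, e.2]
    exact Nat.mul_lt_mul_of_pos_right this hm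
  · have : Fintype.card (G.C 0) * Fintype.card (G.C 1) < m * m := by
      by_cases e0 : Fintype.card (G.C 0) = m
      · rw [e0]
        exact Nat.mul_lt_mul_of_pos_left (lt_of_le_of_ne l1 fun h => e ⟨e0, h⟩) hm
      · calc _ ≤ Fintype.card (G.C 0) * m := Nat.mul_le_mul_left _ l1
          _ < m * m := Nat.mul_lt_mul_of_pos_right (lt_of_le_of_ne l0 e0) hm
    exact this.trans_le (Nat.mul_le_mul_right _ hmw)

end WLCGame

theorem Protocol.IsWaitOrMove.ECT_lt {π : Protocol} (hπ : π.IsWaitOrMove) {G : WLCGame} {m : ℕ}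
    [NeZero m] (hG : G.IsChoiceGame m) (hne : ¬ G.Isomorphic (CM m)) :
    π.ECT G < ENNReal.ofReal (3 - 2 / m) := by
  classical
  have hm : 1 ≤ m := NeZero.pos m
  have hm' : (1 : ℝ) ≤ m := by exact_mod_cast hm
  have h0 : 0 < Fintype.card (G.C 0) := Fintype.card_pos
  have h1 : 0 < Fintype.card (G.C 1) := Fintype.card_pos
  refine (hπ.ECT_le G).trans_lt ((ENNReal.ofReal_lt_ofReal_iff ?_).2 ?_)
  · have : (2 : ℝ) / m ≤ 2 := div_le_self (by norm_num) hm'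
    linarith
  · have h := card_mul_card_lt hG hne
    have h' : ((Fintype.card (G.C 0) * Fintype.card (G.C 1) : ℕ) : ℝ) <
      (Fintype.card G.W * m : ℕ) := by exact_mod_cast h
    push_cast at h'
    have : (2 : ℝ) / m < 2 * (Fintype.card G.W : ℝ) /
        (Fintype.card (G.C 0) * Fintype.card (G.C 1)) := by
      rw [div_lt_div_iff₀ (by positivity) (by positivity)]
      linarith
    linarith

theorem waitOrMove_ECT_CM_le (m : ℕ) [NeZero m] :
    waitOrMove.ECT (CM m) ≤ ENNReal.ofReal (3 - 2 / m) := by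
  classical
  have hm : 0 < m := NeZero.pos m
  refine (waitOrMove_isWaitOrMove.ECT_le (CM m)).trans (ENNReal.ofReal_le_ofReal ?_)
  have hW : m ≤ Fintype.card (CM m).W := by
    have := Fintype.card_le_of_surjective _ ((CM m).surjective_eval_W 0)
    exact (Fintype.card_fin m).symm.le.trans this
  have hC : ∀ i, Fintype.card ((CM m).C i) = m := fun _ => Fintype.card_fin m
  rw [hC, hC]
  have hW' : (m : ℝ) ≤ Fintype.card (CM m).W := by exact_mod_cast hW
  have : (2 : ℝ) / m ≤ 2 * (Fintype.card (CM m).W : ℝ) / (m * m) := by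
    rw [div_le_div_iff₀ (by positivity) (by positivity)]
    nlinarith
  linarith

/-! ### The quadratic inequality for one round of a mirrored stage. -/

/-- The number of fixed points of a permutation. -/
def Equiv.Perm.numFixed {α : Type} [Fintype α] [DecidableEq α] (φ : Equiv.Perm α) : ℕ :=
  (Finset.univ.filter fun a => φ a = a).card

theorem Equiv.Perm.numFixed_mul_swap {α : Type} [Fintype α] [DecidableEq α] {φ : Equiv.Perm α}
    {a b : α} (hab : a ≠ b) (ha : φ a = a) (hb : φ b = b) :
    (φ * Equiv.swap a b).numFixed + 2 = φ.numFixed := by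
  obtain ⟨ψ, hψ⟩ : ∃ ψ, ψ = φ * Equiv.swap a b := ⟨_, rfl⟩
  have h0 : ∀ c, ψ c = φ (Equiv.swap a b c) := fun c => by rw [hψ, Equiv.Perm.mul_apply]
  have h1 : ψ a = b := by rw [h0, Equiv.swap_apply_left, hb]
  have h2 : ψ b = a := by rw [h0, Equiv.swap_apply_right, ha]
  have h : (Finset.univ.filter fun c => φ c = c) =
      insert a (insert b (Finset.univ.filter fun c => ψ c = c)) := by
    ext c
    simp only [Finset.mem_filter, Finset.mem_univ, true_and, Finset.mem_insert]
    by_cases hc1 : c = a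
    · simp [hc1, ha]
    by_cases hc2 : c = b
    · simp [hc2, hb]
    rw [h0, Equiv.swap_apply_of_ne_of_ne hc1 hc2]
    simp [hc1, hc2]
  rw [← hψ, Equiv.Perm.numFixed, Equiv.Perm.numFixed, h, Finset.card_insert_of_notMem,
    Finset.card_insert_of_notMem]
  · simp [h2, hab]
  · simp [h1, hab, hab.symm]

/-- The sum bounds the expected time after the round when player 0 draws `a` and player 1 draws `b`
and plays `φ b`. The value is 0 for coordination, `x` when the mirror pair of a moved edge is
played, `y` when two distinct fixed edges are hit, and 1 (at least one more round) otherwise. -/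
theorem le_sum_mirrored {α : Type} [Fintype α] [DecidableEq α] {φ : Equiv.Perm α}
    (hφ : ∀ a, φ (φ a) = a) {P : α → ℝ} (hP : ∀ a, 0 ≤ P a) (hsum : ∑ a, P a = 1)
    (hfix : ∀ a b, φ a = a → φ b = b → P a = P b) {x y μ : ℝ} (hμ : 0 ≤ μ)
    (hmove : ∀ a, φ a ≠ a → 2 * μ ≤ x ∧ μ ≤ 1)
    (hy : (φ.numFixed : ℝ) ^ 2 * μ ≤ φ.numFixed * (φ.numFixed - 1) * y) :
    μ ≤ ∑ a, ∑ b, P a * P b * (if a = φ b then 0 else if a = b then x else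
      if φ a = a ∧ φ b = b then y else 1) := by
  set F : α → ℝ := fun a => if φ a = a then 1 else 0 with hF
  set M : α → ℝ := fun a => if φ a = a then 0 else 1 with hM
  have hswap : ∀ a b, a = φ b ↔ b = φ a := fun a b =>
    ⟨fun h => by rw [h, hφ], fun h => by rw [h, hφ]⟩
  -- Every pair is charged `μ`. On moved edges the surplus `μ` at `b = a`, available because `2 * μ
  -- ≤ x`, pays for the deficit at `b = φ a`; on pairs of fixed edges the charge is replaced by the
  -- exact value.
  have hpt : ∀ a b, P a * P b * μ + (if b = a then P a * P b * (M a * μ) else 0)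
      - (if b = φ a then P a * P b * (M a * μ) else 0) + P a * F a * (P b * F b) * (y - μ)
      - (if b = a then P a * P b * (F a * y) else 0) ≤
      P a * P b * (if a = φ b then 0 else if a = b then x else
        if φ a = a ∧ φ b = b then y else 1) := by
    intro a b
    have hab : 0 ≤ P a * P b := mul_nonneg (hP a) (hP b)
    by_cases h1 : a = φ b
    · have h1' := (hswap a b).1 h1
      by_cases ha : φ a = a
      · have hba : b = a := h1'.trans ha
        subst hba
        simp only [hF, hM, ha, if_true]
        linarith
      · have hba : b ≠ a := fun h => ha (h1'.symm.trans h)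
        simp only [hF, hM, hba, h1.symm, h1'.symm, if_true, if_false]
        linarith
    have h1' : b ≠ φ a := fun h => h1 ((hswap a b).2 h)
    by_cases h2 : a = b
    · subst h2
      have ha : φ a ≠ a := fun h => h1 h.symm
      have := mul_le_mul_of_nonneg_left (hmove a ha).1 hab
      simp only [hF, hM, ha, h1, if_true, if_false]
      linarith
    have h2' : b ≠ a := fun h => h2 h.symm
    simp only [h1, h1', h2, h2', if_false]
    by_cases ha : φ a = a
    · by_cases hb : φ b = b
      · simp only [hF, ha, hb, and_self, if_true]
        linarith
      · have := mul_le_mul_of_nonneg_left (hmove b hb).2 hab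
        simp only [hF, hb, and_false, if_false]
        linarith
    · have := mul_le_mul_of_nonneg_left (hmove a ha).2 hab
      simp only [hF, ha, false_and, if_false]
      linarith
  refine le_trans ?_ (Finset.sum_le_sum fun a _ => Finset.sum_le_sum fun b _ => hpt a b)
  have hinner : ∀ a, ∑ b, (P a * P b * μ + (if b = a then P a * P b * (M a * μ) else 0)
      - (if b = φ a then P a * P b * (M a * μ) else 0) + P a * F a * (P b * F b) * (y - μ)
      - (if b = a then P a * P b * (F a * y) else 0)) =
      P a * μ + (M a * P a ^ 2) * μ - (M a * (P a * P (φ a))) * μ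
      + P a * F a * (∑ b, P b * F b) * (y - μ) - (P a ^ 2 * F a) * y := by
    intro a
    simp only [Finset.sum_add_distrib, Finset.sum_sub_distrib, Finset.sum_ite_eq',
      Finset.mem_univ, if_true, ← Finset.sum_mul, ← Finset.mul_sum, hsum]
    ring
  rw [Finset.sum_congr rfl fun a _ => hinner a]
  simp only [Finset.sum_add_distrib, Finset.sum_sub_distrib, ← Finset.sum_mul, hsum]
  have hMφ : ∀ a, M (φ a) = M a := fun a => by
    simp only [hM, EmbeddingLike.apply_eq_iff_eq]
  have hre : ∑ a, M a * P (φ a) ^ 2 = ∑ a, M a * P a ^ 2 := by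
    rw [← Equiv.sum_comp φ fun a => M a * P a ^ 2]
    simp only [hMφ]
  -- After reindexing by `φ` this square is twice the difference between the agreement mass and the
  -- coordination mass on moved edges.
  have hsq : 0 ≤ ∑ a, M a * (P a - P (φ a)) ^ 2 :=
    Finset.sum_nonneg fun a _ => mul_nonneg (by simp only [hM]; split_ifs <;> norm_num)
      (sq_nonneg _)
  have hexp : ∑ a, M a * (P a - P (φ a)) ^ 2 =
      ∑ a, M a * P a ^ 2 - 2 * ∑ a, M a * (P a * P (φ a)) + ∑ a, M a * P (φ a) ^ 2 := by
    rw [Finset.mul_sum, ← Finset.sum_sub_distrib, ← Finset.sum_add_distrib]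
    exact Finset.sum_congr rfl fun a _ => by ring
  have hmoved : 0 ≤ (∑ a, M a * P a ^ 2 - ∑ a, M a * (P a * P (φ a))) * μ :=
    mul_nonneg (by linarith) hμ
  have hfixed : 0 ≤ (∑ a, P a * F a) * (∑ a, P a * F a) * (y - μ) - (∑ a, P a ^ 2 * F a) * y := by
    by_cases hex : ∃ a, φ a = a
    · obtain ⟨c, hc⟩ := hex
      have hk : ∑ a, F a = φ.numFixed := by simp [hF, Equiv.Perm.numFixed]
      have h1 : ∑ a, P a * F a = P c * φ.numFixed := by
        rw [← hk, Finset.mul_sum]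
        refine Finset.sum_congr rfl fun a _ => ?_
        by_cases ha : φ a = a
        · rw [hfix a c ha hc]
        · simp [hF, ha]
      have h2 : ∑ a, P a ^ 2 * F a = P c ^ 2 * φ.numFixed := by
        rw [← hk, Finset.mul_sum]
        refine Finset.sum_congr rfl fun a _ => ?_
        by_cases ha : φ a = a
        · rw [hfix a c ha hc]
        · simp [hF, ha]
      rw [h1, h2]
      have := mul_le_mul_of_nonneg_left hy (sq_nonneg (P c))
      linarith
    · have h0 : ∀ a, F a = 0 := fun a => if_neg fun h => hex ⟨a, h⟩
      simp [h0]
  linarith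

/-! ### Mirrored stages of the choice matching game. -/

namespace WLCGame.CM

variable {m : ℕ} [NeZero m]

/-- The edge of the choice of player `i` in `σ`. -/
def edge (σ : (CM m).Profile) (i : Fin 2) : Fin m := σ i

/-- The profile with given edges. -/
def profile (a b : Fin m) : (CM m).Profile := (piFinTwoEquiv (CM m).C).symm (a, b)

/-- The probability that player `i` selects the choice in the edge `a`. -/
def prob (π : Protocol) (H : (CM m).History) (i : Fin 2) (a : Fin m) : ℝ≥0∞ := π (CM m) H i a

theorem edge_profile_zero (a b : Fin m) : edge (profile a b) 0 = a := rfl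

theorem edge_profile_one (a b : Fin m) : edge (profile a b) 1 = b := rfl

theorem ext_edge {σ τ : (CM m).Profile} (h0 : edge σ 0 = edge τ 0) (h1 : edge σ 1 = edge τ 1) :
    σ = τ :=
  profile_eq h0 h1

theorem prob_ne_top (π : Protocol) (H : (CM m).History) (i : Fin 2) (a : Fin m) :
    prob π H i a ≠ ⊤ := PMF.apply_ne_top _ _

theorem sum_prob (π : Protocol) (H : (CM m).History) (i : Fin 2) : ∑ a, prob π H i a = 1 :=
  π.sum_apply (CM m) H i

open Classical in
theorem ECTFrom_eq (π : Protocol) (H : (CM m).History) :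
    π.ECTFrom (CM m) H = 1 + ∑ a, ∑ b, if a = b then 0 else
      prob π H 0 a * prob π H 1 b * π.ECTFrom (CM m) (H ++ [profile a b]) := by
  rw [Protocol.ECTFrom_eq_one_add, Finset.sum_filter, sum_profile]
  congr 1
  refine Finset.sum_congr rfl fun a _ => Finset.sum_congr rfl fun b _ => ?_
  rw [Protocol.profileProb_eq_mul]
  by_cases hab : (a : Fin m) = b
  · exact (if_neg fun h => h hab).trans (if_pos hab).symm
  · exact (if_pos hab).trans (if_neg hab).symm

end WLCGame.CM

open WLCGame.CM

/-- In the stage of `CM m` with history `H`, exchanging the players and renaming the choices by the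
involution `φ` is a symmetry, and `φ` moves the edges that have been touched. -/
structure WLCGame.Mirrored {m : ℕ} [NeZero m] (φ : Equiv.Perm (Fin m)) (H : (CM m).History) :
    Prop where
  involutive : ∀ a, φ (φ a) = a
  moved : ∀ σ ∈ H, φ (edge σ 0) ≠ edge σ 0
  mirrored : ∀ σ ∈ H, edge σ 1 = φ (edge σ 0)

namespace WLCGame.Mirrored

variable {m : ℕ} [NeZero m] {φ : Equiv.Perm (Fin m)} {H : (CM m).History}

theorem append_of_moved (h : Mirrored φ H) {a : Fin m} (ha : φ a ≠ a) :
    Mirrored φ (H ++ [profile a (φ a)]) where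
  involutive := h.involutive
  moved τ hτ := by
    rcases List.mem_append.1 hτ with hτ | hτ
    · exact h.moved τ hτ
    · rw [List.mem_singleton.1 hτ]; exact ha
  mirrored τ hτ := by
    rcases List.mem_append.1 hτ with hτ | hτ
    · exact h.mirrored τ hτ
    · rw [List.mem_singleton.1 hτ]; rfl

/-- The new transposition is disjoint from the moved points of `φ`, so the product is still an
involution and agrees with `φ` on all edges touched earlier. -/
theorem append_of_fixed (h : Mirrored φ H) {a b : Fin m} (ha : φ a = a) (hb : φ b = b)
    (hab : a ≠ b) : Mirrored (φ * Equiv.swap a b) (H ++ [profile a b]) := by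
  have key : ∀ c, φ c ≠ c → (φ * Equiv.swap a b) c = φ c := fun c hc => by
    rw [Equiv.Perm.mul_apply, Equiv.swap_apply_of_ne_of_ne]
    · rintro rfl; exact hc ha
    · rintro rfl; exact hc hb
  have keya : (φ * Equiv.swap a b) a = b := by
    rw [Equiv.Perm.mul_apply, Equiv.swap_apply_left, hb]
  have keyb : (φ * Equiv.swap a b) b = a := by
    rw [Equiv.Perm.mul_apply, Equiv.swap_apply_right, ha]
  refine ⟨fun c => ?_, fun τ hτ => ?_, fun τ hτ => ?_⟩
  · by_cases hca : c = a
    · rw [hca, keya, keyb]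
    by_cases hcb : c = b
    · rw [hcb, keyb, keya]
    by_cases hc : φ c = c
    · have : (φ * Equiv.swap a b) c = c := by
        rw [Equiv.Perm.mul_apply, Equiv.swap_apply_of_ne_of_ne hca hcb, hc]
      rw [this, this]
    · rw [key c hc, key (φ c), h.involutive]
      rw [h.involutive]
      exact fun e => hc e.symm
  · rcases List.mem_append.1 hτ with hτ | hτ
    · rw [key _ (h.moved τ hτ)]; exact h.moved τ hτ
    · rw [List.mem_singleton.1 hτ, edge_profile_zero, keya]; exact hab.symm
  · rcases List.mem_append.1 hτ with hτ | hτ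
    · rw [key _ (h.moved τ hτ)]; exact h.mirrored τ hτ
    · rw [List.mem_singleton.1 hτ, edge_profile_zero, edge_profile_one, keya]

/-- Exchanging the players and mirroring the choices. -/
def mirrorRenaming (h : Mirrored φ H) : Renaming (CM m) (CM m) H H where
  perm := Equiv.swap 0 1
  map _ := φ
  win_iff σ := by
    have : edge σ 0 = edge σ 1 ↔ φ (edge σ 1) = φ (edge σ 0) := by
      rw [EmbeddingLike.apply_eq_iff_eq]
      exact eq_comm
    exact this
  hist_eq := by
    symm
    conv_rhs => rw [← List.map_id H]
    refine List.map_congr_left fun σ hσ => ext_edge ?_ ?_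
    · have : φ (edge σ 1) = edge σ 0 := by rw [h.mirrored σ hσ, h.involutive]
      exact this
    · exact (h.mirrored σ hσ).symm

/-- Exchanging two edges that have not been touched. -/
def swapRenaming (h : Mirrored φ H) {a b : Fin m} (ha : φ a = a) (hb : φ b = b) :
    Renaming (CM m) (CM m) H H where
  perm := 1
  map _ := (Equiv.swap a b : Equiv.Perm (Fin m))
  win_iff σ := by
    have : edge σ 0 = edge σ 1 ↔ Equiv.swap a b (edge σ 0) = Equiv.swap a b (edge σ 1) := by
      rw [EmbeddingLike.apply_eq_iff_eq]
    exact this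
  hist_eq := by
    have key : ∀ c, φ c ≠ c → Equiv.swap a b c = c := fun c hc => by
      rw [Equiv.swap_apply_of_ne_of_ne]
      · rintro rfl; exact hc ha
      · rintro rfl; exact hc hb
    symm
    conv_rhs => rw [← List.map_id H]
    refine List.map_congr_left fun σ hσ => ext_edge (key _ (h.moved σ hσ)) (key (edge σ 1) ?_)
    rw [h.mirrored σ hσ, h.involutive]
    exact (h.moved σ hσ).symm

theorem prob_one {π : Protocol} (hπ : π.IsStructural) (h : Mirrored φ H) (a : Fin m) :
    prob π H 1 (φ a) = prob π H 0 a :=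
  (hπ _ _ _ _ h.mirrorRenaming 1 a).symm

theorem prob_eq_of_fixed {π : Protocol} (hπ : π.IsStructural) (h : Mirrored φ H) {a b : Fin m}
    (ha : φ a = a) (hb : φ b = b) : prob π H 0 a = prob π H 0 b := by
  have h1 : prob π H 0 a = prob π H 0 (Equiv.swap a b a) :=
    hπ _ _ _ _ (h.swapRenaming ha hb) 0 a
  rw [h1, Equiv.swap_apply_left]

/-- Reindexing the choice of player 1 by `φ` turns the round into two independent draws from one
distribution. -/
theorem ECTFrom_eq {π : Protocol} (hπ : π.IsStructural) (h : Mirrored φ H) :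
    π.ECTFrom (CM m) H = 1 + ∑ a, ∑ b, prob π H 0 a * prob π H 0 b *
      (if a = φ b then 0 else π.ECTFrom (CM m) (H ++ [profile a (φ b)])) := by
  rw [CM.ECTFrom_eq]
  congr 1
  refine Finset.sum_congr rfl fun a _ => ?_
  rw [← Equiv.sum_comp φ]
  refine Finset.sum_congr rfl fun b _ => ?_
  rw [prob_one hπ h]
  by_cases hab : a = φ b
  · rw [if_pos hab, if_pos hab, mul_zero]
  · rw [if_neg hab, if_neg hab]

/-- This transfers `le_sum_mirrored` to the protocol: `x` bounds stages with the same `φ`, and `y`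
stages with two fixed points fewer. -/
theorem one_add_le_ECTFrom {π : Protocol} (hπ : π.IsStructural) (h : Mirrored φ H) {x y μ : ℝ}
    (hx0 : 0 ≤ x) (hy0 : 0 ≤ y) (hμ : 0 ≤ μ)
    (hx : ∀ H' : (CM m).History, Mirrored φ H' → ENNReal.ofReal x ≤ π.ECTFrom (CM m) H')
    (hy : ∀ (φ' : Equiv.Perm (Fin m)) (H' : (CM m).History), Mirrored φ' H' →
      φ'.numFixed + 2 = φ.numFixed → ENNReal.ofReal y ≤ π.ECTFrom (CM m) H')
    (hmove : ∀ a, φ a ≠ a → 2 * μ ≤ x ∧ μ ≤ 1)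
    (hle : (φ.numFixed : ℝ) ^ 2 * μ ≤ φ.numFixed * (φ.numFixed - 1) * y) :
    ENNReal.ofReal (1 + μ) ≤ π.ECTFrom (CM m) H := by
  have hP : ∀ a, prob π H 0 a = ENNReal.ofReal (prob π H 0 a).toReal := fun a =>
    (ENNReal.ofReal_toReal (prob_ne_top π H 0 a)).symm
  have hsum : ∑ a, (prob π H 0 a).toReal = 1 := by
    rw [← ENNReal.toReal_sum fun a _ => prob_ne_top π H 0 a, sum_prob, ENNReal.toReal_one]
  have hreal := le_sum_mirrored h.involutive (P := fun a => (prob π H 0 a).toReal)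
    (fun _ => ENNReal.toReal_nonneg) hsum
    (fun a b ha hb => congrArg ENNReal.toReal (prob_eq_of_fixed hπ h ha hb)) hμ hmove hle
  have hV0 : ∀ a b : Fin m, 0 ≤ (if a = φ b then 0 else if a = b then x else
      if φ a = a ∧ φ b = b then y else (1 : ℝ)) := fun a b => by
    split_ifs <;> first | exact le_rfl | assumption | exact zero_le_one
  have hV : ∀ a b : Fin m, ENNReal.ofReal (if a = φ b then 0 else if a = b then x else
      if φ a = a ∧ φ b = b then y else (1 : ℝ)) ≤ if a = φ b then 0 else
        π.ECTFrom (CM m) (H ++ [profile a (φ b)]) := fun a b => by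
    split_ifs with h1 h2 h3
    · simp
    · subst h2
      exact hx _ (h.append_of_moved fun e => h1 e.symm)
    · rw [h3.2]
      exact hy _ _ (h.append_of_fixed h3.1 h3.2 h2)
        (Equiv.Perm.numFixed_mul_swap h2 h3.1 h3.2)
    · rw [ENNReal.ofReal_one]
      exact Protocol.one_le_ECTFrom _ _ _
  have hPP : ∀ a b, 0 ≤ (prob π H 0 a).toReal * (prob π H 0 b).toReal := fun _ _ =>
    mul_nonneg ENNReal.toReal_nonneg ENNReal.toReal_nonneg
  rw [ECTFrom_eq hπ h, ENNReal.ofReal_add zero_le_one hμ, ENNReal.ofReal_one]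
  refine add_le_add le_rfl ((ENNReal.ofReal_le_ofReal hreal).trans ?_)
  rw [ENNReal.ofReal_sum_of_nonneg fun a _ => Finset.sum_nonneg fun b _ =>
    mul_nonneg (hPP a b) (hV0 a b)]
  refine Finset.sum_le_sum fun a _ => ?_
  rw [ENNReal.ofReal_sum_of_nonneg fun b _ => mul_nonneg (hPP a b) (hV0 a b)]
  refine Finset.sum_le_sum fun b _ => ?_
  rw [ENNReal.ofReal_mul (hPP a b), ENNReal.ofReal_mul ENNReal.toReal_nonneg, ← hP, ← hP]
  exact mul_le_mul_right (hV a b) _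

end WLCGame.Mirrored

/-! ### Induction on the number of fixed edges. -/

/-- A lower bound on the expected coordination time in mirrored stages with `k` untouched edges. -/
noncomputable def mirroredBound (k : ℕ) : ℝ := if k = 1 then 1 else if k = 3 then 5 / 3 else 2

theorem mirroredBound_le_two (k : ℕ) : mirroredBound k ≤ 2 := by
  unfold mirroredBound; split_ifs <;> norm_num

theorem one_le_mirroredBound (k : ℕ) : 1 ≤ mirroredBound k := by
  unfold mirroredBound; split_ifs <;> norm_num

/-- The fixed-edge condition of the induction step. It is tight from 1 to 3, where `1 + (2/3) * 1 =
5/3`; from 3 to 5 there is already room for the bound 2, as `(4/5) * (5/3) ≥ 1`. -/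
theorem sq_mul_mirroredBound_le (k : ℕ) : ((k + 2 : ℕ) : ℝ) ^ 2 * (mirroredBound (k + 2) - 1) ≤
    (k + 2 : ℕ) * ((k + 2 : ℕ) - 1) * mirroredBound k := by
  by_cases h1 : k = 1
  · subst h1; norm_num [mirroredBound]
  by_cases h3 : k = 3
  · subst h3; norm_num [mirroredBound]
  have hk : mirroredBound k = 2 := by simp [mirroredBound, h1, h3]
  have h0 : (0 : ℝ) ≤ k := k.cast_nonneg
  have := mirroredBound_le_two (k + 2)
  rw [hk]
  push_cast
  nlinarith [mul_nonneg (sq_nonneg ((k : ℝ) + 2)) (sub_nonneg.2 this)]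

namespace Protocol

variable {m : ℕ} [NeZero m]

theorem mirroredBound_le_ECTFrom {π : Protocol} (hπ : π.IsStructural)
    (k : ℕ) (φ : Equiv.Perm (Fin m)) (H : (CM m).History) (h : Mirrored φ H)
    (hk : φ.numFixed = k) : ENNReal.ofReal (mirroredBound k) ≤ π.ECTFrom (CM m) H := by
  induction k using Nat.strong_induction_on generalizing φ H with
  | _ k ih =>
  by_cases hk1 : k = 1
  · simp only [hk1, mirroredBound, if_true, ENNReal.ofReal_one]
    exact one_le_ECTFrom _ _ _
  obtain ⟨y, hy0, hyk, hy⟩ : ∃ y : ℝ, 0 ≤ y ∧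
      (k : ℝ) ^ 2 * (mirroredBound k - 1) ≤ k * (k - 1) * y ∧
      ∀ (φ' : Equiv.Perm (Fin m)) (H' : (CM m).History), Mirrored φ' H' →
        φ'.numFixed + 2 = k → ENNReal.ofReal y ≤ π.ECTFrom (CM m) H' := by
    match k, hk1, ih with
    -- Without fixed points the pair of fixed edges never occurs, so any `y` serves.
    | 0, _, _ => exact ⟨0, le_rfl, by simp, fun _ _ _ h => by omega⟩
    | 1, h, _ => exact absurd rfl h
    | j + 2, _, ih =>
      exact ⟨mirroredBound j, zero_le_one.trans (one_le_mirroredBound j),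
        sq_mul_mirroredBound_le j, fun φ' H' h' e => ih j (by omega) φ' H' h' (by omega)⟩
  -- Playing a mirror pair of moved edges keeps `k` unchanged, so induction on `k` alone does not
  -- suffice; the infimum over all stages with `k` fixed points is compared with itself.
  set I : ℝ≥0∞ := ⨅ (φ' : Equiv.Perm (Fin m)) (H' : (CM m).History) (_ : Mirrored φ' H')
    (_ : φ'.numFixed = k), π.ECTFrom (CM m) H' with hI
  have hI_le : ∀ (φ' : Equiv.Perm (Fin m)) (H' : (CM m).History), Mirrored φ' H' →
      φ'.numFixed = k → I ≤ π.ECTFrom (CM m) H' := fun φ' H' h' e =>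
    iInf_le_of_le φ' (iInf_le_of_le H' (iInf_le_of_le h' (iInf_le_of_le e le_rfl)))
  have hI_one : 1 ≤ I := le_iInf fun _ => le_iInf fun _ => le_iInf fun _ => le_iInf fun _ =>
    one_le_ECTFrom _ _ _
  have hmin : min I 2 ≠ ⊤ := ((min_le_right _ _).trans_lt ENNReal.ofNat_lt_top).ne
  -- `I` may be infinite; truncating at 2 loses nothing, because no value of `mirroredBound` exceeds
  -- 2.
  set z : ℝ := (min I 2).toReal with hz
  have hzI : ENNReal.ofReal z ≤ I := by
    rw [hz, ENNReal.ofReal_toReal hmin]; exact min_le_left _ _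
  have hz1 : 1 ≤ z := by
    rw [hz, ← ENNReal.toReal_one]
    exact ENNReal.toReal_mono hmin (le_min hI_one (by norm_num))
  have hz2 : z ≤ 2 := by
    have := ENNReal.toReal_mono (by norm_num) (min_le_right I 2)
    simpa [hz] using this
  have he1 := one_le_mirroredBound k
  have he2 := mirroredBound_le_two k
  set μ : ℝ := min (z / 2) (mirroredBound k - 1) with hμ
  have hμ1 : μ ≤ z / 2 := min_le_left _ _
  have hμ2 : μ ≤ mirroredBound k - 1 := min_le_right _ _
  have hμ0 : 0 ≤ μ := le_min (by linarith) (by linarith)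
  have hstep : ENNReal.ofReal (1 + μ) ≤ I := by
    refine le_iInf fun φ' => le_iInf fun H' => le_iInf fun h' => le_iInf fun e => ?_
    refine h'.one_add_le_ECTFrom hπ (x := z) (y := y) (by linarith) hy0 hμ0
      (fun H'' h'' => hzI.trans (hI_le φ' H'' h'' e))
      (fun φ'' H'' h'' e' => hy φ'' H'' h'' (e'.trans e))
      (fun _ _ => ⟨by linarith, by linarith⟩) ?_
    rw [e]
    exact (mul_le_mul_of_nonneg_left hμ2 (sq_nonneg _)).trans hyk
  have hμz : 1 + μ ≤ z := by
    have h2 : ENNReal.ofReal (1 + μ) ≤ 2 :=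
      ENNReal.ofReal_le_of_le_toReal (by simp; linarith)
    have := ENNReal.toReal_mono hmin (le_min hstep h2)
    rwa [ENNReal.toReal_ofReal (by linarith)] at this
  -- Either `1 + z / 2 ≤ z`, hence `z ≥ 2`, or `1 + (mirroredBound k - 1) ≤ z`.
  have hle : mirroredBound k ≤ z := by
    rcases min_choice (z / 2) (mirroredBound k - 1) with hc | hc <;> rw [← hμ] at hc <;> linarith
  exact (ENNReal.ofReal_le_ofReal hle).trans (hzI.trans (hI_le φ H h hk))

/-- A first-round miss leaves `m - 2` fixed edges, and excluding `m = 3, 5` keeps this number away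
from the exceptional values 1 and 3 of `mirroredBound`. -/
theorem IsStructural.le_ECT_CM {π : Protocol} (hπ : π.IsStructural)
    (hm : m ∉ ({1, 3, 5} : Set ℕ)) : ENNReal.ofReal (3 - 2 / m) ≤ π.ECT (CM m) := by
  have hm0 : m ≠ 0 := NeZero.ne m
  simp only [Set.mem_insert_iff, Set.mem_singleton_iff, not_or] at hm
  have hcard : (1 : Equiv.Perm (Fin m)).numFixed = m := by simp [Equiv.Perm.numFixed]
  have hm1 : (1 : ℝ) ≤ m := by exact_mod_cast NeZero.pos m
  have hdiv : (2 : ℝ) / m ≤ 2 := div_le_self (by norm_num) hm1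
  have h1 : Mirrored (1 : Equiv.Perm (Fin m)) [] :=
    ⟨fun _ => rfl, fun _ h => absurd h List.not_mem_nil, fun _ h => absurd h List.not_mem_nil⟩
  -- The identity moves no edge, so the trivial `x = 0` suffices; `μ` solves `m² μ = m (m - 1) * 2`.
  have := h1.one_add_le_ECTFrom hπ (x := 0) (y := 2) (μ := 2 - 2 / m) le_rfl (by norm_num)
    (by linarith) (by simp)
    (fun φ' H' h' e => by
      have hb := mirroredBound_le_ECTFrom hπ _ φ' H' h' rfl
      rw [hcard] at e
      rwa [mirroredBound, if_neg (by omega), if_neg (by omega)] at hb)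
    (fun _ h => absurd rfl h)
    (by
      rw [hcard]
      refine le_of_eq ?_
      field_simp)
  rw [ECT]
  convert this using 2
  ring

end Protocol

theorem WLCGame.isOptimalECT_CM {m : ℕ} [NeZero m] (hm : m ∉ ({1, 3, 5} : Set ℕ)) :
    (CM m).IsOptimalECT (ENNReal.ofReal (3 - 2 / m)) :=
  ⟨⟨waitOrMove, waitOrMove_isStructural, (waitOrMove_ECT_CM_le m).antisymm
    (waitOrMove_isStructural.le_ECT_CM hm)⟩, by rintro _ ⟨π, hπ, rfl⟩; exact hπ.le_ECT_CM hm⟩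

end

theorem mainTheorem9 (m : ℕ) [NeZero m] (hm : m ∉ ({1, 3, 5} : Set ℕ))
    (G : WLCGame) (hG : G.IsChoiceGame m) (hne : ¬ G.Isomorphic (WLCGame.CM m)) :
    ∃ e : ENNReal, (WLCGame.CM m).IsOptimalECT e ∧
      ∀ π : Protocol, π.IsWaitOrMove → π.ECT G < e :=
  ⟨_, WLCGame.isOptimalECT_CM hm, fun _ hπ => hπ.ECT_lt hG hne⟩
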